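/- Let $A\in\mathbb{R}^{n\times n}$, $B\in\mathbb{R}^{n\times m}$, $C\in\mathbb{R}^{p\times n}$ and $q\ge 1$. Let $\mathcal{C}_q$ be the set of all block matrices $$\mathsf{K}=\begin{bmatrix} D_{\mathsf K} & C_{\mathsf K}\\ B_{\mathsf K} & A_{\mathsf K}\end{bmatrix}\in\mathbb{R}^{(m+q)\times(p+q)},\qquad A_{\mathsf K}\in\mathbb{R}^{q\times q},$$ such that $D_{\mathsf K}=0$ and the closed-loop matrix $\begin{bmatrix} A & BC_{\mathsf K}\\ B_{\mathsf K}C & A_{\mathsf K}\end{bmatrix}$ is stable (all its eigenvalues have negative real part). For $T\in\mathrm{GL}_q(\mathbb{R})$ put $$\mathscr{T}_q(T,\mathsf K)=\begin{bmatrix} I_m & 0\\ 0 & T\end{bmatrix}\begin{bmatrix} D_{\mathsf K} & C_{\mathsf K}\\ B_{\mathsf K} & A_{\mathsf K}\end{bmatrix}\begin{bmatrix} I_p & 0\\ 0 & T\end{bmatrix}^{-1},\qquad \mathcal{O}_{\mathsf K}=\{\mathscr{T}_q(T,\mathsf K)\mid T\in\mathrm{GL}_q(\mathbb{R})\}.$$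 A subset $M$ of a Euclidean space $E$ is called a $C^\infty$ manifold of dimension $k$ in $E$ if every point of $M$ has an open neighbourhood $U$ in $E$ such that $U\cap M$ is diffeomorphic to an open subset of $\mathbb{R}^k$ (a map on a subset of a Euclidean space being $C^\infty$ if, near each point of the subset, it is the restriction of a $C^\infty$ map defined on an open set of the ambient space); a subset $N\subseteq M$ of a $C^\infty$ manifold $M$ in $E$ is called an embedded $C^\infty$ submanifold of $M$ if it is a $C^\infty$ manifold in $E$. **Proposition.** Let $\mathsf K\in\mathcal{C}_q$ be controllable and observable, that is, $$\operatorname{rank}\begin{bmatrix} B_{\mathsf K} & A_{\mathsf K}B_{\mathsf K} & \cdots & A_{\mathsf K}^{q-1}B_{\mathsf K}\end{bmatrix}=q=\operatorname{rank}\begin{bmatrix} C_{\mathsf K}\\ C_{\mathsf K}A_{\mathsf K}\\ \vdots\\ C_{\mathsf K}A_{\mathsf K}^{q-1}\end{bmatrix}.$$ Then $\mathcal{C}_q$ is a $C^\infty$ manifold in $\mathbb{R}^{(m+q)\times(p+q)}$, and $\mathcal{O}_{\mathsf K}$ is contained in $\mathcal{C}_q$ and is an embedded $C^\infty$ submanifold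 of $\mathcal{C}_q$ of dimension $q^2$. Moreover, $\mathcal{O}_{\mathsf K}$ has exactly two path-connected components, namely $$\mathcal{O}_{\mathsf K}^+=\{\mathscr{T}_q(T,\mathsf K)\mid T\in\mathrm{GL}_q(\mathbb{R}),\ \det T>0\}\quad\text{and}\quad \mathcal{O}_{\mathsf K}^-=\{\mathscr{T}_q(T,\mathsf K)\mid T\in\mathrm{GL}_q(\mathbb{R}),\ \det T<0\}.$$ -/

import Mathlib

open scoped ContDiff MatrixGroups

/-! ### Smooth manifolds in Euclidean spaces -/

/-- A map `φ : X → Y` between subsets `X ⊆ E` and `Y ⊆ F` of Euclidean spaces (given as the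
restriction of a function `E → F`; only the values on `X` matter) is `C^∞` on `X` if around every
point of `X` it coincides on `X` with an indefinitely differentiable function that is defined on
an open neighbourhood of the point in the ambient space. -/
def IsSmoothOnSubset {E F : Type*} [NormedAddCommGroup E] [NormedSpace ℝ E]
    [NormedAddCommGroup F] [NormedSpace ℝ F] (φ : E → F) (X : Set E) : Prop :=
  ∀ x ∈ X, ∃ U : Set E, IsOpen U ∧ x ∈ U ∧
    ∃ φ' : E → F, ContDiffOn ℝ ∞ φ' U ∧ Set.EqOn φ φ' (U ∩ X)

/-- Two subsets of Euclidean spaces are diffeomorphic if there are mutually inverse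
`C^∞` maps between them. -/
def AreDiffeomorphic {E F : Type*} [NormedAddCommGroup E] [NormedSpace ℝ E]
    [NormedAddCommGroup F] [NormedSpace ℝ F] (X : Set E) (Y : Set F) : Prop :=
  ∃ (φ : E → F) (ψ : F → E),
    Set.MapsTo φ X Y ∧ Set.MapsTo ψ Y X ∧ Set.LeftInvOn ψ φ X ∧ Set.RightInvOn ψ φ Y ∧
      IsSmoothOnSubset φ X ∧ IsSmoothOnSubset ψ Y

/-- A subset `M` of a Euclidean space `E` is a `C^∞` manifold of dimension `k` in `E` if every
point of `M` has an open neighbourhood `U` in `E` such that `U ∩ M` is diffeomorphic to an open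
subset of `ℝ^k`. -/
def IsSmoothManifoldIn {E : Type*} [NormedAddCommGroup E] [NormedSpace ℝ E]
    (k : ℕ) (M : Set E) : Prop :=
  ∀ x ∈ M, ∃ U : Set E, IsOpen U ∧ x ∈ U ∧
    ∃ O : Set (EuclideanSpace ℝ (Fin k)), IsOpen O ∧ AreDiffeomorphic (U ∩ M) O

/-- `N` is an embedded `C^∞` submanifold of dimension `k` of the `C^∞` manifold `M` in the
Euclidean space `E`. -/
def IsEmbeddedSubmanifoldOf {E : Type*} [NormedAddCommGroup E] [NormedSpace ℝ E]
    (k : ℕ) (N M : Set E) : Prop :=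
  (∃ d : ℕ, IsSmoothManifoldIn d M) ∧ N ⊆ M ∧ IsSmoothManifoldIn k N

/-- The set of path-connected components of a subset `S` of a topological space. -/
def pathComponentsOf {X : Type*} [TopologicalSpace X] (S : Set X) : Set (Set X) :=
  {P | ∃ x ∈ S, P = pathComponentIn S x}

/-! ### Linear systems -/

/-- The controllability matrix `[B  AB  ⋯  A^(k-1) B]`; its columns are indexed by the number of
the block and the column in the block. -/
def controllabilityMatrix {k l : ℕ} (A : Matrix (Fin k) (Fin k) ℝ)
    (B : Matrix (Fin k) (Fin l) ℝ) : Matrix (Fin k) (Fin k × Fin l) ℝ :=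
  Matrix.of fun i jc => (A ^ (jc.1 : ℕ) * B) i jc.2

/-- The observability matrix with the blocks `C, CA, …, CA^(k-1)` below each other; its rows are
indexed by the number of the block and the row in the block. -/
def observabilityMatrix {k l : ℕ} (C : Matrix (Fin l) (Fin k) ℝ)
    (A : Matrix (Fin k) (Fin k) ℝ) : Matrix (Fin k × Fin l) (Fin k) ℝ :=
  Matrix.of fun jr i => (C * A ^ (jr.1 : ℕ)) jr.2 i

/-- `(A, B)` is controllable. -/
def IsControllablePair {k l : ℕ} (A : Matrix (Fin k) (Fin k) ℝ)
    (B : Matrix (Fin k) (Fin l) ℝ) : Prop :=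
  (controllabilityMatrix A B).rank = k

/-- `(C, A)` is observable. -/
def IsObservablePair {k l : ℕ} (C : Matrix (Fin l) (Fin k) ℝ)
    (A : Matrix (Fin k) (Fin k) ℝ) : Prop :=
  (observabilityMatrix C A).rank = k

/-- A real square matrix is stable if all its complex eigenvalues have negative real part. -/
def IsStableMatrix {ι : Type*} [Fintype ι] [DecidableEq ι] (M : Matrix ι ι ℝ) : Prop :=
  ∀ z ∈ spectrum ℂ (M.map (algebraMap ℝ ℂ)), z.re < 0

/-! ### Dynamical controllers

A controller of order `q` for a plant with `m` inputs and `p` outputs is given by the block matrix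
`K = [D_K, C_K; B_K, A_K]` of size `(m + q) × (p + q)`. -/

/-- The linear space of all block matrices `K = [D_K, C_K; B_K, A_K]`. -/
abbrev ControllerMatrix (m p q : ℕ) : Type :=
  Matrix (Fin m ⊕ Fin q) (Fin p ⊕ Fin q) ℝ

-- Matrix spaces are Euclidean spaces with the Frobenius norm.
attribute [local instance] Matrix.frobeniusNormedAddCommGroup Matrix.frobeniusNormedSpace

/-- The block `A_K`. -/
def controllerA {m p q : ℕ} (K : ControllerMatrix m p q) : Matrix (Fin q) (Fin q) ℝ :=
  K.toBlocks₂₂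

/-- The block `B_K`. -/
def controllerB {m p q : ℕ} (K : ControllerMatrix m p q) : Matrix (Fin q) (Fin p) ℝ :=
  K.toBlocks₂₁

/-- The block `C_K`. -/
def controllerC {m p q : ℕ} (K : ControllerMatrix m p q) : Matrix (Fin m) (Fin q) ℝ :=
  K.toBlocks₁₂

/-- The block `D_K`. -/
def controllerD {m p q : ℕ} (K : ControllerMatrix m p q) : Matrix (Fin m) (Fin p) ℝ :=
  K.toBlocks₁₁

/-- The closed-loop matrix `[A, B C_K; B_K C, A_K]`. -/
def closedLoopMatrix {n m p q : ℕ} (A : Matrix (Fin n) (Fin n) ℝ) (B : Matrix (Fin n) (Fin m) ℝ)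
    (C : Matrix (Fin p) (Fin n) ℝ) (K : ControllerMatrix m p q) :
    Matrix (Fin n ⊕ Fin q) (Fin n ⊕ Fin q) ℝ :=
  Matrix.fromBlocks A (B * controllerC K) (controllerB K * C) (controllerA K)

/-- The set `𝒞_q` of the strictly proper controllers of order `q` that internally stabilize the
plant `x' = A x + B u`, `y = C x`. -/
def stabilizingControllers {n m p : ℕ} (A : Matrix (Fin n) (Fin n) ℝ)
    (B : Matrix (Fin n) (Fin m) ℝ) (C : Matrix (Fin p) (Fin n) ℝ) (q : ℕ) :
    Set (ControllerMatrix m p q) :=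
  {K | controllerD K = 0 ∧ IsStableMatrix (closedLoopMatrix A B C K)}

/-- The similarity transformation
`𝒯_q(T, K) = [I, 0; 0, T] [D_K, C_K; B_K, A_K] [I, 0; 0, T]⁻¹`. -/
noncomputable def simTransform {m p q : ℕ} (T : GL (Fin q) ℝ) (K : ControllerMatrix m p q) :
    ControllerMatrix m p q :=
  (Matrix.fromBlocks 1 0 0 (T : Matrix (Fin q) (Fin q) ℝ) :
      Matrix (Fin m ⊕ Fin q) (Fin m ⊕ Fin q) ℝ) * K *
    (Matrix.fromBlocks 1 0 0 (T : Matrix (Fin q) (Fin q) ℝ) :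
      Matrix (Fin p ⊕ Fin q) (Fin p ⊕ Fin q) ℝ)⁻¹

/-- The similarity orbit `𝒪_K`. -/
def simOrbit {m p q : ℕ} (K : ControllerMatrix m p q) : Set (ControllerMatrix m p q) :=
  {L | ∃ T : GL (Fin q) ℝ, L = simTransform T K}

/-- The part `𝒪_K⁺` of the orbit given by the `T` with `det T > 0`. -/
def simOrbitPos {m p q : ℕ} (K : ControllerMatrix m p q) : Set (ControllerMatrix m p q) :=
  {L | ∃ T : GL (Fin q) ℝ, 0 < (T : Matrix (Fin q) (Fin q) ℝ).det ∧ L = simTransform T K}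

/-- The part `𝒪_K⁻` of the orbit given by the `T` with `det T < 0`. -/
def simOrbitNeg {m p q : ℕ} (K : ControllerMatrix m p q) : Set (ControllerMatrix m p q) :=
  {L | ∃ T : GL (Fin q) ℝ, (T : Matrix (Fin q) (Fin q) ℝ).det < 0 ∧ L = simTransform T K}

/-! ### Smooth manifolds from parametrizations -/

/-! The orbit is a copy of `GL_q`. Under `T` the controllability matrix of the controller is
multiplied by `T` on the left (`controllabilityMatrix_conj`). Controllability supplies a right
inverse `R` of this matrix for `K`, so multiplying the controllability matrix of any orbit point by
`R` returns `T` (`orbitCoordinate_simTransform`). This inverse of the orbit map is polynomial on the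
whole ambient space. Hence the open set `det ≠ 0` in a space of dimension `q ^ 2` is a single global
chart of the orbit, and the path components of the orbit are those of `GL_q`, which the sign of the
determinant separates (`joinedIn_det_ne_zero_of_pos_iff_pos`).

The set of stabilizing controllers is a relatively open part of the linear space `D_K = 0`, because
stability is an open condition. It contains the orbit because the closed-loop matrices of equivalent
controllers are similar. -/

theorem ContDiffOn.isSmoothOnSubset {E F : Type*} [NormedAddCommGroup E] [NormedSpace ℝ E]
    [NormedAddCommGroup F] [NormedSpace ℝ F] {φ : E → F} {X U : Set E}
    (hφ : ContDiffOn ℝ ∞ φ U) (hU : IsOpen U) (hX : X ⊆ U) : IsSmoothOnSubset φ X :=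
  fun _ hx => ⟨U, hU, hX hx, φ, hφ, fun _ _ => rfl⟩

/-- A subset with a global chart in a finite-dimensional space `V` is a manifold of
dimension `dim V`. -/
theorem isSmoothManifoldIn_of_globalChart {E V : Type*} [NormedAddCommGroup E] [NormedSpace ℝ E]
    [NormedAddCommGroup V] [NormedSpace ℝ V] [FiniteDimensional ℝ V] {k : ℕ}
    (hk : Module.finrank ℝ V = k) {M : Set E} {O : Set V} (hO : IsOpen O)
    {φ : E → V} {ψ : V → E} (hφ : ContDiff ℝ ∞ φ) (hψ : ContDiffOn ℝ ∞ ψ O)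
    (hMO : Set.MapsTo φ M O) (hOM : Set.MapsTo ψ O M)
    (hl : Set.LeftInvOn ψ φ M) (hr : Set.RightInvOn ψ φ O) :
    IsSmoothManifoldIn k M := by
  intro x _
  let e : V ≃L[ℝ] EuclideanSpace ℝ (Fin k) :=
    ContinuousLinearEquiv.ofFinrankEq (by simp [hk])
  refine ⟨Set.univ, isOpen_univ, Set.mem_univ x, e.symm ⁻¹' O,
    hO.preimage e.symm.continuous, fun y => e (φ y), fun z => ψ (e.symm z), ?_, ?_, ?_, ?_, ?_, ?_⟩
  · intro y hy
    simpa using hMO hy.2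
  · intro z hz
    exact ⟨Set.mem_univ _, hOM hz⟩
  · intro y hy
    simpa using hl hy.2
  · intro z hz
    have := hr hz
    simp [this]
  · exact (e.contDiff.comp hφ).contDiffOn.isSmoothOnSubset isOpen_univ (Set.subset_univ _)
  · exact (hψ.comp e.symm.contDiff.contDiffOn fun _ h => h).isSmoothOnSubset
      (hO.preimage e.symm.continuous) subset_rfl

theorem isSmoothManifoldIn_submodule_inter {E : Type*} [NormedAddCommGroup E] [NormedSpace ℝ E]
    [FiniteDimensional ℝ E] (W : Submodule ℝ E) {S : Set E} (hS : IsOpen S) :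
    IsSmoothManifoldIn (Module.finrank ℝ W) ((W : Set E) ∩ S) := by
  -- A linear projection onto `W` serves as the chart: it is smooth on all of `E`.
  obtain ⟨g, hg⟩ := W.subtype.exists_leftInverse_of_injective W.ker_subtype
  have hg' : ∀ w : W, g w = w := fun w => LinearMap.congr_fun hg w
  refine isSmoothManifoldIn_of_globalChart (V := W) rfl (O := (Subtype.val : W → E) ⁻¹' S)
    (hS.preimage continuous_subtype_val) (φ := g) (ψ := W.subtypeL)
    (LinearMap.toContinuousLinearMap g).contDiff W.subtypeL.contDiff.contDiffOn ?_ ?_ ?_ ?_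
  · rintro x ⟨hx, hxS⟩
    simpa [hg' ⟨x, hx⟩] using hxS
  · intro w hw
    exact ⟨w.2, hw⟩
  · rintro x ⟨hx, hxS⟩
    simp [hg' ⟨x, hx⟩]
  · intro w hw
    simp [hg' w]

/-! ### Smooth matrix-valued functions -/

section MatrixCalculus

variable {E : Type*} [NormedAddCommGroup E] [NormedSpace ℝ E] {ι κ l : Type*}
  [Fintype ι] [Fintype κ] [Fintype l] {s : Set E} {r : WithTop ℕ∞}

theorem contDiffOn_matrix_iff {f : E → Matrix ι κ ℝ} :
    ContDiffOn ℝ r f s ↔ ∀ i j, ContDiffOn ℝ r (fun x => f x i j) s := by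
  let e : Matrix ι κ ℝ ≃L[ℝ] (ι → κ → ℝ) :=
    (LinearEquiv.refl ℝ (ι → κ → ℝ) : Matrix ι κ ℝ ≃ₗ[ℝ] (ι → κ → ℝ)).toContinuousLinearEquiv
  rw [← e.comp_contDiffOn_iff, contDiffOn_pi]
  simp_rw [contDiffOn_pi]
  rfl

theorem ContDiffOn.matrix_mul {f : E → Matrix ι κ ℝ} {g : E → Matrix κ l ℝ}
    (hf : ContDiffOn ℝ r f s) (hg : ContDiffOn ℝ r g s) :
    ContDiffOn ℝ r (fun x => f x * g x) s := by
  rw [contDiffOn_matrix_iff] at *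
  intro i j
  simp only [Matrix.mul_apply]
  exact ContDiffOn.sum fun k _ => (hf i k).mul (hg k j)

variable [DecidableEq ι]

theorem ContDiffOn.matrix_det {f : E → Matrix ι ι ℝ} (hf : ContDiffOn ℝ r f s) :
    ContDiffOn ℝ r (fun x => (f x).det) s := by
  rw [contDiffOn_matrix_iff] at hf
  simp only [Matrix.det_apply]
  exact ContDiffOn.sum fun σ _ => (contDiffOn_prod fun i _ => hf _ _).const_smul _

/-- Cramer's rule: the entries of the adjugate are determinants of `f x` with one row replaced by a
constant unit vector. -/
theorem ContDiffOn.matrix_inv {f : E → Matrix ι ι ℝ} (hf : ContDiffOn ℝ r f s)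
    (h0 : ∀ x ∈ s, (f x).det ≠ 0) : ContDiffOn ℝ r (fun x => (f x)⁻¹) s := by
  rw [contDiffOn_matrix_iff]
  intro i j
  simp only [Matrix.inv_def, Matrix.smul_apply, Ring.inverse_eq_inv', smul_eq_mul,
    Matrix.adjugate_apply]
  refine (hf.matrix_det.inv h0).mul (ContDiffOn.matrix_det ?_)
  rw [contDiffOn_matrix_iff] at hf ⊢
  intro a b
  by_cases h : a = j
  · subst h
    simpa using contDiffOn_const
  · simpa [Matrix.updateRow_ne h] using hf a b

theorem ContDiffOn.matrix_pow {f : E → Matrix ι ι ℝ} (hf : ContDiffOn ℝ r f s) (k : ℕ) :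
    ContDiffOn ℝ r (fun x => f x ^ k) s := by
  induction k with
  | zero => simpa using contDiffOn_const
  | succ k ih => simpa [pow_succ] using ih.matrix_mul hf

end MatrixCalculus

/-! ### The stable matrices form an open set -/

-- The spectrum is upper hemicontinuous in a Banach algebra, and the open left half-plane is open.
attribute [local instance] Matrix.frobeniusNormedRing Matrix.frobeniusNormedAlgebra in
theorem isOpen_setOf_isStableMatrix {ι : Type*} [Fintype ι] [DecidableEq ι] :
    IsOpen {M : Matrix ι ι ℝ | IsStableMatrix M} := by
  have h : IsOpen {M : Matrix ι ι ℂ | spectrum ℂ M ⊆ {z | z.re < 0}} := by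
    exact upperHemicontinuous_iff_isOpen_preimage_Iic.1
      (upperHemicontinuous_spectrum ℂ (Matrix ι ι ℂ)) _
      (isOpen_lt Complex.continuous_re continuous_const)
  have hc : Continuous fun M : Matrix ι ι ℝ => M.map (algebraMap ℝ ℂ) :=
    continuous_id.matrix_map (continuous_algebraMap ℝ ℂ)
  exact h.preimage hc

/-! ### Path components of the general linear group -/

section PathComponents

variable {ι : Type*} [Fintype ι] [DecidableEq ι]

/-- Intermediate value theorem along the path. -/
theorem JoinedIn.pos_iff_pos {X : Type*} [TopologicalSpace X] {F : Set X} {x y : X}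
    (h : JoinedIn F x y) {g : X → ℝ} (hg : Continuous g) (h0 : ∀ z ∈ F, g z ≠ 0) :
    0 < g x ↔ 0 < g y := by
  have key : ∀ {x y : X}, JoinedIn F x y → 0 < g x → 0 < g y := by
    intro x y h hx
    by_contra hy
    obtain ⟨t, ht⟩ := mem_range_of_exists_le_of_exists_ge (c := 0)
      (hg.comp h.somePath.continuous) ⟨1, by simpa using hy⟩ ⟨0, by simpa using hx.le⟩
    exact h0 _ (h.somePath_mem t) ht
  exact ⟨key h, key h.symm⟩

theorem JoinedIn.image_of_continuousOn {X Y : Type*} [TopologicalSpace X] [TopologicalSpace Y]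
    {F : Set X} {G : Set Y} {x y : X} (h : JoinedIn F x y) {f : X → Y} (hf : ContinuousOn f F)
    (hFG : Set.MapsTo f F G) : JoinedIn G (f x) (f y) := by
  refine JoinedIn.ofLine (f := fun s => f (h.somePath.extend s)) ?_ (by simp) (by simp) ?_
  · refine (hf.comp_continuous (h.somePath.continuous_extend) fun s => ?_).continuousOn
    exact h.somePath_mem _
  · rintro _ ⟨s, -, rfl⟩
    exact hFG (h.somePath_mem _)

theorem joinedIn_det_ne_zero_mul {M M' N N' : Matrix ι ι ℝ}
    (hM : JoinedIn {X : Matrix ι ι ℝ | X.det ≠ 0} M M')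
    (hN : JoinedIn {X : Matrix ι ι ℝ | X.det ≠ 0} N N') :
    JoinedIn {X : Matrix ι ι ℝ | X.det ≠ 0} (M * N) (M' * N') := by
  have h1 := hM.image_of_continuousOn (f := (· * N)) (by fun_prop)
    (G := {X : Matrix ι ι ℝ | X.det ≠ 0}) fun X hX => by
      simpa using ⟨hX, hN.source_mem⟩
  have h2 := hN.image_of_continuousOn (f := (M' * ·)) (by fun_prop)
    (G := {X : Matrix ι ι ℝ | X.det ≠ 0}) fun X hX => by
      simpa using ⟨hM.target_mem, hX⟩
  exact h1.trans h2

theorem joinedIn_det_ne_zero_transvection (t : Matrix.TransvectionStruct ι ℝ) :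
    JoinedIn {X : Matrix ι ι ℝ | X.det ≠ 0} t.toMatrix 1 := by
  refine JoinedIn.symm (JoinedIn.ofLine (f := fun s => Matrix.transvection t.i t.j (s * t.c))
    ?_ (by simp) (by simp [Matrix.TransvectionStruct.toMatrix]) ?_)
  · refine Continuous.continuousOn (continuous_matrix fun a b => ?_)
    simp only [Matrix.transvection, Matrix.add_apply, Matrix.single_apply]
    split_ifs <;> fun_prop
  · rintro _ ⟨s, -, rfl⟩
    simp [Matrix.det_transvection_of_ne _ _ t.hij]

/-- The path runs through reflections. -/
theorem joinedIn_det_ne_zero_diagonal_neg_one (a b : ι) :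
    JoinedIn {X : Matrix ι ι ℝ | X.det ≠ 0} (Matrix.diagonal (Function.update 1 a (-1)))
      (Matrix.diagonal (Function.update 1 b (-1))) := by
  -- The segment from `e_a` to `e_b`. Its coordinates always sum to 1, so it avoids 0, even if `a =
  -- b`.
  let v : ℝ → ι → ℝ := fun s => Pi.single a (1 - s) + Pi.single b s
  have hvc : Continuous v := by
    refine continuous_pi fun i => ?_
    simp only [v, Pi.add_apply, Pi.single_apply]
    split_ifs <;> fun_prop
  have hv : ∀ s, v s ⬝ᵥ v s ≠ 0 := by
    intro s h
    rw [dotProduct_self_eq_zero] at h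
    have h1 : ∑ i, v s i = 1 := by
      simp [v, Finset.sum_add_distrib]
    simp [h] at h1
  have hend : ∀ c : ι, (1 : Matrix ι ι ℝ) - (2 : ℝ) • Matrix.vecMulVec (Pi.single c 1) (Pi.single c 1) =
      Matrix.diagonal (Function.update 1 c (-1)) := by
    intro c
    ext i j
    by_cases hij : i = j
    · subst hij
      by_cases hic : i = c
      · subst hic; simp [Matrix.vecMulVec_apply]; norm_num
      · simp [Matrix.vecMulVec_apply, hic]
    · by_cases hic : i = c
      · subst hic; simp [Matrix.vecMulVec_apply, hij, Ne.symm hij]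
      · simp [Matrix.vecMulVec_apply, hij, hic]
  refine JoinedIn.ofLine
    (f := fun s => 1 - (2 / (v s ⬝ᵥ v s)) • Matrix.vecMulVec (v s) (v s)) ?_ ?_ ?_ ?_
  · exact (continuous_const.sub ((continuous_const.div (hvc.dotProduct hvc) hv).smul
      (hvc.matrix_vecMulVec hvc))).continuousOn
  · simp [v, ← hend]
  · simp [v, ← hend]
  · rintro _ ⟨s, -, rfl⟩
    have : (1 - (2 / (v s ⬝ᵥ v s)) • Matrix.vecMulVec (v s) (v s)).det = -1 := by
      -- `det (1 - XY) = det (1 - YX)` reduces to a 1 × 1 determinant, `1 - 2 = -1`.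
      rw [Matrix.vecMulVec_eq Unit, ← Matrix.smul_mul, Matrix.det_one_sub_mul_comm,
        Matrix.mul_smul, Matrix.det_unique]
      have h2 : (Matrix.replicateRow Unit (v s) * Matrix.replicateCol Unit (v s)) default default =
          v s ⬝ᵥ v s := rfl
      rw [Matrix.sub_apply, Matrix.smul_apply, h2, smul_eq_mul, div_mul_cancel₀ _ (hv s)]
      norm_num
    simp [this]

theorem joinedIn_det_ne_zero_diagonal_update {a : ι} {c d : ℝ} (h : 0 < c * d) :
    JoinedIn {X : Matrix ι ι ℝ | X.det ≠ 0} (Matrix.diagonal (Function.update 1 a c))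
      (Matrix.diagonal (Function.update 1 a d)) := by
  refine JoinedIn.ofLine
    (f := fun s => Matrix.diagonal (Function.update 1 a ((1 - s) * c + s * d)))
    (Continuous.continuousOn ?_) (by simp) (by simp) ?_
  · exact (continuous_const.update a (by fun_prop)).matrix_diagonal
  · rintro _ ⟨s, ⟨h0, h1⟩, rfl⟩
    simp only [Set.mem_ofPred_eq, Matrix.det_diagonal,
      Finset.prod_update_of_mem (Finset.mem_univ a)]
    simp
    rcases pos_and_pos_or_neg_and_neg_of_mul_pos h with ⟨hc, hd⟩ | ⟨hc, hd⟩
    · rcases h0.eq_or_lt with rfl | h0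
      · simp [hc.ne']
      · have := mul_pos h0 hd
        have := mul_nonneg (sub_nonneg.2 h1) hc.le
        linarith
    · rcases h0.eq_or_lt with rfl | h0
      · simp [hc.ne]
      · have := mul_neg_of_pos_of_neg h0 hd
        have := mul_nonpos_of_nonneg_of_nonpos (sub_nonneg.2 h1) hc.le
        linarith

/-- `M` is a product of transvections and a diagonal matrix. The alternative passes to products
because the reflection squares to 1. -/
theorem joinedIn_det_ne_zero_one_or_reflection (i₀ : ι) (M : Matrix ι ι ℝ) (hM : M.det ≠ 0) :
    JoinedIn {X : Matrix ι ι ℝ | X.det ≠ 0} M 1 ∨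
      JoinedIn {X : Matrix ι ι ℝ | X.det ≠ 0} M
        (Matrix.diagonal (Function.update 1 i₀ (-1))) := by
  have hmul : ∀ M N : Matrix ι ι ℝ,
      (JoinedIn {X : Matrix ι ι ℝ | X.det ≠ 0} M 1 ∨ JoinedIn {X : Matrix ι ι ℝ | X.det ≠ 0} M
        (Matrix.diagonal (Function.update 1 i₀ (-1)))) →
      (JoinedIn {X : Matrix ι ι ℝ | X.det ≠ 0} N 1 ∨ JoinedIn {X : Matrix ι ι ℝ | X.det ≠ 0} N
        (Matrix.diagonal (Function.update 1 i₀ (-1)))) →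
      (JoinedIn {X : Matrix ι ι ℝ | X.det ≠ 0} (M * N) 1 ∨
        JoinedIn {X : Matrix ι ι ℝ | X.det ≠ 0} (M * N)
        (Matrix.diagonal (Function.update 1 i₀ (-1)))) := by
    rintro M N (h | h) (h' | h')
    · exact Or.inl (by simpa using joinedIn_det_ne_zero_mul h h')
    · exact Or.inr (by simpa using joinedIn_det_ne_zero_mul h h')
    · exact Or.inr (by simpa using joinedIn_det_ne_zero_mul h h')
    · left
      have := joinedIn_det_ne_zero_mul h h'
      rwa [Matrix.diagonal_mul_diagonal, show (fun i => Function.update (1 : ι → ℝ) i₀ (-1) i *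
        Function.update (1 : ι → ℝ) i₀ (-1) i) = fun _ => 1 from ?_, Matrix.diagonal_one] at this
      funext i
      by_cases hi : i = i₀
      · subst hi; simp
      · simp [hi]
  refine Matrix.diagonal_transvection_induction_of_det_ne_zero _ M hM (fun D hD => ?_)
    (fun t => Or.inl (joinedIn_det_ne_zero_transvection t)) (fun A B _ _ => hmul A B)
  have hD' : ∀ i, D i ≠ 0 := by
    simpa [Matrix.det_diagonal, Finset.prod_ne_zero_iff] using hD
  -- The diagonal matrix is built up one entry at a time.
  suffices h : ∀ s : Finset ι,
      JoinedIn {X : Matrix ι ι ℝ | X.det ≠ 0} (Matrix.diagonal fun i => if i ∈ s then D i else 1) 1 ∨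
      JoinedIn {X : Matrix ι ι ℝ | X.det ≠ 0} (Matrix.diagonal fun i => if i ∈ s then D i else 1)
        (Matrix.diagonal (Function.update 1 i₀ (-1))) by
    simpa using h Finset.univ
  intro s
  induction s using Finset.induction_on with
  | empty => exact Or.inl (by simpa using JoinedIn.refl (by simp))
  | insert a s ha ih =>
    have hprod : (Matrix.diagonal fun i => if i ∈ insert a s then D i else 1) =
        Matrix.diagonal (Function.update 1 a (D a)) *
          Matrix.diagonal fun i => if i ∈ s then D i else 1 := by
      rw [Matrix.diagonal_mul_diagonal]
      congr 1
      funext i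
      by_cases hi : i = a
      · subst hi; simp [ha]
      · simp [hi]
    rw [hprod]
    refine hmul _ _ ?_ ih
    -- A negative entry is deformed to `-1` and the resulting reflection moved to `i₀`; a positive
    -- entry is deformed to 1.
    rcases (hD' a).lt_or_gt with h | h
    · exact Or.inr ((joinedIn_det_ne_zero_diagonal_update (d := -1) (by linarith)).trans
        (joinedIn_det_ne_zero_diagonal_neg_one a i₀))
    · left
      have := joinedIn_det_ne_zero_diagonal_update (a := a) (c := D a) (d := 1) (by linarith)
      simpa using this

theorem joinedIn_det_ne_zero_of_pos_iff_pos [Nonempty ι] {M N : Matrix ι ι ℝ} (hM : M.det ≠ 0)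
    (hN : N.det ≠ 0) (h : 0 < M.det ↔ 0 < N.det) :
    JoinedIn {X : Matrix ι ι ℝ | X.det ≠ 0} M N := by
  let i₀ : ι := Classical.arbitrary ι
  have hdet : Continuous fun X : Matrix ι ι ℝ => X.det := continuous_id.matrix_det
  have hE : (Matrix.diagonal (Function.update (1 : ι → ℝ) i₀ (-1))).det = -1 := by
    simp [Matrix.det_diagonal, Finset.prod_update_of_mem]
  rcases joinedIn_det_ne_zero_one_or_reflection i₀ M hM with h1 | h1 <;>
  rcases joinedIn_det_ne_zero_one_or_reflection i₀ N hN with h2 | h2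
  · exact h1.trans h2.symm
  · have a := h1.pos_iff_pos hdet fun _ hz => hz
    have b := h2.pos_iff_pos hdet fun _ hz => hz
    rw [hE] at b
    rw [Matrix.det_one] at a
    exact absurd (b.1 (h.1 (a.2 one_pos))) (by norm_num)
  · have a := h1.pos_iff_pos hdet fun _ hz => hz
    have b := h2.pos_iff_pos hdet fun _ hz => hz
    rw [hE] at a
    rw [Matrix.det_one] at b
    exact absurd (a.1 (h.2 (b.2 one_pos))) (by norm_num)
  · exact h1.trans h2.symm

end PathComponents

/-! ### The set of stabilizing controllers -/

theorem exists_isSmoothManifoldIn_stabilizingControllers {n m p : ℕ}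
    (A : Matrix (Fin n) (Fin n) ℝ) (B : Matrix (Fin n) (Fin m) ℝ) (C : Matrix (Fin p) (Fin n) ℝ)
    (q : ℕ) : ∃ d : ℕ, IsSmoothManifoldIn d (stabilizingControllers A B C q) := by
  let D : ControllerMatrix m p q →ₗ[ℝ] Matrix (Fin m) (Fin p) ℝ :=
    { toFun := controllerD, map_add' := fun _ _ => rfl, map_smul' := fun _ _ => rfl }
  have hcont : Continuous fun K : ControllerMatrix m p q => closedLoopMatrix A B C K := by
    refine Continuous.matrix_fromBlocks continuous_const
      (continuous_const.matrix_mul ?_) (Continuous.matrix_mul ?_ continuous_const) ?_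
    · exact continuous_matrix fun i j => continuous_id.matrix_elem (Sum.inl i) (Sum.inr j)
    · exact continuous_matrix fun i j => continuous_id.matrix_elem (Sum.inr i) (Sum.inl j)
    · exact continuous_matrix fun i j => continuous_id.matrix_elem (Sum.inr i) (Sum.inr j)
  exact ⟨_, isSmoothManifoldIn_submodule_inter (LinearMap.ker D)
    (isOpen_setOf_isStableMatrix.preimage hcont)⟩

/-! ### The similarity orbit -/

section Orbit

variable {m p q : ℕ}

theorem simTransform_eq (T : GL (Fin q) ℝ) (K : ControllerMatrix m p q) :
    simTransform T K = Matrix.fromBlocks (controllerD K)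
      (controllerC K * (T : Matrix (Fin q) (Fin q) ℝ)⁻¹)
      ((T : Matrix (Fin q) (Fin q) ℝ) * controllerB K)
      ((T : Matrix (Fin q) (Fin q) ℝ) * controllerA K * (T : Matrix (Fin q) (Fin q) ℝ)⁻¹) := by
  have hT : IsUnit (T : Matrix (Fin q) (Fin q) ℝ).det := (Matrix.isUnit_iff_isUnit_det _).1 T.isUnit
  have hinv : (Matrix.fromBlocks 1 0 0 (T : Matrix (Fin q) (Fin q) ℝ) :
      Matrix (Fin p ⊕ Fin q) (Fin p ⊕ Fin q) ℝ)⁻¹ =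
      Matrix.fromBlocks 1 0 0 (T : Matrix (Fin q) (Fin q) ℝ)⁻¹ := by
    apply Matrix.inv_eq_right_inv
    simp [Matrix.fromBlocks_multiply, Matrix.mul_nonsing_inv _ hT]
  rw [simTransform, hinv]
  nth_rewrite 1 [← Matrix.fromBlocks_toBlocks K]
  simp [Matrix.fromBlocks_multiply, controllerA, controllerB, controllerC, controllerD]

theorem controllabilityMatrix_conj {l : ℕ} (T : GL (Fin q) ℝ) (A : Matrix (Fin q) (Fin q) ℝ)
    (B : Matrix (Fin q) (Fin l) ℝ) :
    controllabilityMatrix ((T : Matrix (Fin q) (Fin q) ℝ) * A *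
      (T : Matrix (Fin q) (Fin q) ℝ)⁻¹) ((T : Matrix (Fin q) (Fin q) ℝ) * B) =
      (T : Matrix (Fin q) (Fin q) ℝ) * controllabilityMatrix A B := by
  have hT : IsUnit (T : Matrix (Fin q) (Fin q) ℝ).det := (Matrix.isUnit_iff_isUnit_det _).1 T.isUnit
  have hpow : ∀ k : ℕ, ((T : Matrix (Fin q) (Fin q) ℝ) * A * (T : Matrix (Fin q) (Fin q) ℝ)⁻¹) ^ k =
      (T : Matrix (Fin q) (Fin q) ℝ) * A ^ k * (T : Matrix (Fin q) (Fin q) ℝ)⁻¹ := by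
    intro k
    rw [← Matrix.coe_units_inv, Units.conj_pow]
  ext i ⟨j, c⟩
  simp only [controllabilityMatrix, Matrix.of_apply, hpow]
  rw [Matrix.mul_assoc, Matrix.nonsing_inv_mul_cancel_left _ _ hT, Matrix.mul_assoc]
  simp [Matrix.mul_apply]

theorem IsControllablePair.exists_rightInverse {l : ℕ} {A : Matrix (Fin q) (Fin q) ℝ}
    {B : Matrix (Fin q) (Fin l) ℝ} (h : IsControllablePair A B) :
    ∃ R : Matrix (Fin q × Fin l) (Fin q) ℝ, controllabilityMatrix A B * R = 1 := by
  rw [← Matrix.mulVec_surjective_iff_exists_right_inverse]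
  have : LinearMap.range (controllabilityMatrix A B).mulVecLin = ⊤ := by
    apply Submodule.eq_top_of_finrank_eq
    simpa [IsControllablePair, Matrix.rank] using h
  exact LinearMap.range_eq_top.1 this

/-- With a right inverse `R` of the controllability matrix of `K`, the transformation `T` can be
recovered from `𝒯_q(T, K)`. -/
def orbitCoordinate (R : Matrix (Fin q × Fin p) (Fin q) ℝ) (L : ControllerMatrix m p q) :
    Matrix (Fin q) (Fin q) ℝ :=
  controllabilityMatrix (controllerA L) (controllerB L) * R

theorem orbitCoordinate_simTransform {R : Matrix (Fin q × Fin p) (Fin q) ℝ}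
    {K : ControllerMatrix m p q}
    (hR : controllabilityMatrix (controllerA K) (controllerB K) * R = 1) (T : GL (Fin q) ℝ) :
    orbitCoordinate R (simTransform T K) = (T : Matrix (Fin q) (Fin q) ℝ) := by
  rw [orbitCoordinate, simTransform_eq]
  simp only [controllerA, controllerB, Matrix.toBlocks_fromBlocks₂₂, Matrix.toBlocks_fromBlocks₂₁]
  rw [controllabilityMatrix_conj, Matrix.mul_assoc]
  simp only [controllerA, controllerB] at hR
  rw [hR, Matrix.mul_one]

theorem contDiff_orbitCoordinate (R : Matrix (Fin q × Fin p) (Fin q) ℝ) :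
    ContDiff ℝ ∞ (orbitCoordinate R : ControllerMatrix m p q → _) := by
  rw [← contDiffOn_univ]
  have hid := contDiffOn_matrix_iff.1
    (contDiffOn_id : ContDiffOn ℝ ∞ (id : ControllerMatrix m p q → _) Set.univ)
  have hA : ContDiffOn ℝ ∞ (controllerA : ControllerMatrix m p q → _) Set.univ :=
    contDiffOn_matrix_iff.2 fun i j => hid (Sum.inr i) (Sum.inr j)
  have hB : ContDiffOn ℝ ∞ (controllerB : ControllerMatrix m p q → _) Set.univ :=
    contDiffOn_matrix_iff.2 fun i j => hid (Sum.inr i) (Sum.inl j)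
  refine ContDiffOn.matrix_mul (contDiffOn_matrix_iff.2 ?_) contDiffOn_const
  rintro i ⟨j, c⟩
  exact contDiffOn_matrix_iff.1 ((hA.matrix_pow j).matrix_mul hB) i c

/-- The orbit map, extended to all matrices. -/
noncomputable def orbitMap (K : ControllerMatrix m p q) (T : Matrix (Fin q) (Fin q) ℝ) :
    ControllerMatrix m p q :=
  Matrix.fromBlocks (controllerD K) (controllerC K * T⁻¹) (T * controllerB K)
    (T * controllerA K * T⁻¹)

theorem orbitMap_eq_simTransform (K : ControllerMatrix m p q) {T : Matrix (Fin q) (Fin q) ℝ}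
    (hT : T.det ≠ 0) :
    orbitMap K T = simTransform (Matrix.GeneralLinearGroup.mkOfDetNeZero T hT) K := by
  have hval : (Matrix.GeneralLinearGroup.mkOfDetNeZero T hT : Matrix (Fin q) (Fin q) ℝ) = T := rfl
  rw [simTransform_eq, hval, orbitMap]

theorem contDiffOn_orbitMap (K : ControllerMatrix m p q) :
    ContDiffOn ℝ ∞ (orbitMap K) {T : Matrix (Fin q) (Fin q) ℝ | T.det ≠ 0} := by
  have hinv : ContDiffOn ℝ ∞ (fun T : Matrix (Fin q) (Fin q) ℝ => T⁻¹) {T | T.det ≠ 0} :=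
    contDiffOn_id.matrix_inv fun _ hT => hT
  have hC := (contDiffOn_const (c := controllerC K)).matrix_mul hinv
  have hB := contDiffOn_id.matrix_mul
    (contDiffOn_const (c := controllerB K) (s := {T : Matrix (Fin q) (Fin q) ℝ | T.det ≠ 0})
      (n := ∞) (𝕜 := ℝ))
  have hA := (contDiffOn_id.matrix_mul (contDiffOn_const (c := controllerA K))).matrix_mul hinv
  rw [contDiffOn_matrix_iff] at hA hB hC ⊢
  rintro (i | i) (j | j)
  · exact contDiffOn_const
  · exact hC i j
  · exact hB i j
  · exact hA i j

theorem simTransform_eq_orbitMap (T : GL (Fin q) ℝ) (K : ControllerMatrix m p q) :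
    simTransform T K = orbitMap K T := simTransform_eq T K

theorem isSmoothManifoldIn_simOrbit {K : ControllerMatrix m p q}
    (hctrl : IsControllablePair (controllerA K) (controllerB K)) :
    IsSmoothManifoldIn (q ^ 2) (simOrbit K) := by
  obtain ⟨R, hR⟩ := hctrl.exists_rightInverse
  refine isSmoothManifoldIn_of_globalChart (V := Matrix (Fin q) (Fin q) ℝ)
    (by simp [Module.finrank_matrix, sq]) (O := {T | T.det ≠ 0}) ?_
    (contDiff_orbitCoordinate R) (contDiffOn_orbitMap K) ?_ ?_ ?_ ?_
  · exact isOpen_ne_fun (continuous_id.matrix_det) continuous_const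
  · rintro _ ⟨T, rfl⟩
    rw [orbitCoordinate_simTransform hR]
    exact T.det_ne_zero
  · intro T hT
    exact ⟨_, orbitMap_eq_simTransform K hT⟩
  · rintro _ ⟨T, rfl⟩
    rw [orbitCoordinate_simTransform hR, simTransform_eq_orbitMap]
  · intro T hT
    rw [orbitMap_eq_simTransform K hT, orbitCoordinate_simTransform hR]
    rfl

theorem simOrbit_subset_stabilizingControllers {n : ℕ} {A : Matrix (Fin n) (Fin n) ℝ}
    {B : Matrix (Fin n) (Fin m) ℝ} {C : Matrix (Fin p) (Fin n) ℝ} {K : ControllerMatrix m p q}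
    (hK : K ∈ stabilizingControllers A B C q) : simOrbit K ⊆ stabilizingControllers A B C q := by
  rintro _ ⟨T, rfl⟩
  obtain ⟨hD, hS⟩ := hK
  have hT : IsUnit (T : Matrix (Fin q) (Fin q) ℝ).det := (Matrix.isUnit_iff_isUnit_det _).1 T.isUnit
  refine ⟨by simpa [simTransform_eq, controllerD] using hD, ?_⟩
  -- The change of coordinates leaves the plant state fixed and applies `T` to the controller state.
  let U : (Matrix (Fin n ⊕ Fin q) (Fin n ⊕ Fin q) ℝ)ˣ :=
    { val := Matrix.fromBlocks 1 0 0 (T : Matrix (Fin q) (Fin q) ℝ)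
      inv := Matrix.fromBlocks 1 0 0 (T : Matrix (Fin q) (Fin q) ℝ)⁻¹
      val_inv := by simp [Matrix.fromBlocks_multiply, Matrix.mul_nonsing_inv _ hT]
      inv_val := by simp [Matrix.fromBlocks_multiply, Matrix.nonsing_inv_mul _ hT] }
  have hconj : closedLoopMatrix A B C (simTransform T K) =
      U.val * closedLoopMatrix A B C K * U⁻¹.val := by
    rw [simTransform_eq]
    simp [U, closedLoopMatrix, controllerA, controllerB, controllerC,
      Matrix.fromBlocks_multiply, Matrix.mul_assoc]
  let V := Units.map (algebraMap ℝ ℂ).mapMatrix.toMonoidHom U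
  have hmap : (closedLoopMatrix A B C (simTransform T K)).map (algebraMap ℝ ℂ) =
      V.val * (closedLoopMatrix A B C K).map (algebraMap ℝ ℂ) * V⁻¹.val := by
    rw [hconj, Matrix.map_mul, Matrix.map_mul]
    rfl
  unfold IsStableMatrix
  rw [hmap, spectrum.units_conjugate]
  exact hS

theorem pathComponentIn_simOrbit {K : ControllerMatrix m p q} (hq : 1 ≤ q)
    {R : Matrix (Fin q × Fin p) (Fin q) ℝ}
    (hR : controllabilityMatrix (controllerA K) (controllerB K) * R = 1) (T : GL (Fin q) ℝ) :
    pathComponentIn (simOrbit K) (simTransform T K) =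
      {L | ∃ T' : GL (Fin q) ℝ, (0 < (T : Matrix (Fin q) (Fin q) ℝ).det ↔
        0 < (T' : Matrix (Fin q) (Fin q) ℝ).det) ∧ L = simTransform T' K} := by
  have : Nonempty (Fin q) := ⟨⟨0, hq⟩⟩
  ext L
  constructor
  · intro h
    obtain ⟨T', rfl⟩ := h.target_mem
    refine ⟨T', ?_, rfl⟩
    -- The determinant of the recovered `T` is continuous and nonzero on the orbit, so its sign is
    -- constant along paths.
    have := h.pos_iff_pos (g := fun L => (orbitCoordinate R L).det)
      (contDiff_orbitCoordinate R).continuous.matrix_det ?_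
    · simpa [orbitCoordinate_simTransform hR] using this
    · rintro _ ⟨S, rfl⟩
      simpa only [orbitCoordinate_simTransform hR] using S.det_ne_zero
  · rintro ⟨T', h, rfl⟩
    rw [simTransform_eq_orbitMap, simTransform_eq_orbitMap]
    -- Conversely, a path of invertible matrices is pushed forward by the orbit map.
    refine (joinedIn_det_ne_zero_of_pos_iff_pos T.det_ne_zero T'.det_ne_zero
      h).image_of_continuousOn (contDiffOn_orbitMap K).continuousOn fun S hS => ?_
    exact ⟨_, orbitMap_eq_simTransform K hS⟩

theorem exists_generalLinearGroup_det_neg (hq : 1 ≤ q) :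
    ∃ T : GL (Fin q) ℝ, (T : Matrix (Fin q) (Fin q) ℝ).det < 0 := by
  have hdet : (Matrix.diagonal (Function.update (1 : Fin q → ℝ) ⟨0, hq⟩ (-1))).det = -1 := by
    simp [Matrix.det_diagonal, Finset.prod_update_of_mem]
  refine ⟨Matrix.GeneralLinearGroup.mkOfDetNeZero _ (hdet.trans_ne (by norm_num)), ?_⟩
  exact hdet.trans_lt (by norm_num)

theorem pathComponentsOf_simOrbit {K : ControllerMatrix m p q} (hq : 1 ≤ q)
    (hctrl : IsControllablePair (controllerA K) (controllerB K)) :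
    pathComponentsOf (simOrbit K) = {simOrbitPos K, simOrbitNeg K} := by
  obtain ⟨R, hR⟩ := hctrl.exists_rightInverse
  have hpos : ∀ T : GL (Fin q) ℝ, 0 < (T : Matrix (Fin q) (Fin q) ℝ).det →
      pathComponentIn (simOrbit K) (simTransform T K) = simOrbitPos K := by
    intro T hT
    rw [pathComponentIn_simOrbit hq hR]
    simp [hT, simOrbitPos]
  have hneg : ∀ T : GL (Fin q) ℝ, (T : Matrix (Fin q) (Fin q) ℝ).det < 0 →
      pathComponentIn (simOrbit K) (simTransform T K) = simOrbitNeg K := by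
    intro T hT
    have h' : ∀ S : GL (Fin q) ℝ, (0 < (T : Matrix (Fin q) (Fin q) ℝ).det ↔
        0 < (S : Matrix (Fin q) (Fin q) ℝ).det) ↔ (S : Matrix (Fin q) (Fin q) ℝ).det < 0 := by
      intro S
      rw [iff_false_left hT.not_gt, not_lt]
      exact ⟨fun h => lt_of_le_of_ne h S.det_ne_zero, le_of_lt⟩
    rw [pathComponentIn_simOrbit hq hR]
    simp only [h', simOrbitNeg]
  ext P
  constructor
  · rintro ⟨_, ⟨T, rfl⟩, rfl⟩
    rcases lt_or_gt_of_ne T.det_ne_zero with h | h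
    · exact Or.inr (hneg T h)
    · exact Or.inl (hpos T h)
  · rintro (rfl | rfl)
    · exact ⟨_, ⟨1, rfl⟩, (hpos 1 (by simp)).symm⟩
    · obtain ⟨T, hT⟩ := exists_generalLinearGroup_det_neg hq
      exact ⟨_, ⟨T, rfl⟩, (hneg T hT).symm⟩

/-- Since `T` is determined by its orbit point, `K` itself arises only from `T = 1`, whose
determinant is positive. -/
theorem simOrbitPos_ne_simOrbitNeg {K : ControllerMatrix m p q}
    (hctrl : IsControllablePair (controllerA K) (controllerB K)) :
    simOrbitPos K ≠ simOrbitNeg K := by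
  obtain ⟨R, hR⟩ := hctrl.exists_rightInverse
  intro h
  have h1 : simTransform 1 K ∈ simOrbitNeg K := h ▸ ⟨1, by simp, rfl⟩
  obtain ⟨T, hT, hTK⟩ := h1
  have := congrArg (orbitCoordinate R) hTK
  rw [orbitCoordinate_simTransform hR, orbitCoordinate_simTransform hR] at this
  rw [← this] at hT
  norm_num at hT

end Orbit

theorem mainTheorem8 (n m p q : ℕ) (hq : 1 ≤ q)
    (A : Matrix (Fin n) (Fin n) ℝ) (B : Matrix (Fin n) (Fin m) ℝ) (C : Matrix (Fin p) (Fin n) ℝ)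
    (K : ControllerMatrix m p q) (hK : K ∈ stabilizingControllers A B C q)
    (hctrl : IsControllablePair (controllerA K) (controllerB K))
    (hobs : IsObservablePair (controllerC K) (controllerA K)) :
    IsEmbeddedSubmanifoldOf (q ^ 2) (simOrbit K) (stabilizingControllers A B C q) ∧
      pathComponentsOf (simOrbit K) = {simOrbitPos K, simOrbitNeg K} ∧
      simOrbitPos K ≠ simOrbitNeg K :=
  ⟨⟨exists_isSmoothManifoldIn_stabilizingControllers A B C q,
    simOrbit_subset_stabilizingControllers hK, isSmoothManifoldIn_simOrbit hctrl⟩,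
    pathComponentsOf_simOrbit hq hctrl, simOrbitPos_ne_simOrbitNeg hctrl⟩
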